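/- Let $R$ be an integral domain and let $G$ be a nontrivial (additive) abelian group. Recall that an integral domain is atomic if each of its nonzero nonunits is a finite product of irreducible elements, and that a commutative ring $D$ is called hereditarily atomic if $D$ is an integral domain and every subring of $D$ (containing the identity of $D$) is atomic. Then the following conditions are equivalent. (a) The group algebra $R[G]$ is hereditarily atomic. (b) $R$ is an algebraic field extension of $\mathbb{F}_p$ for some prime $p$, and $G$ is an infinite cyclic group. -/

import Mathlib

/-- A commutative ring `D` is an atomic domain if it is an integral domain in which every
nonzero nonunit is a (finite) product of irreducible elements. -/
def IsAtomicDomain (D : Type*) [CommRing D] : Prop :=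
  IsDomain D ∧
    ∀ a : D, a ≠ 0 → ¬ IsUnit a → ∃ s : Multiset D, (∀ b ∈ s, Irreducible b) ∧ s.prod = a

/-- A commutative ring `D` is a hereditarily atomic domain if it is an integral domain all of
whose subrings (containing the identity of `D`) are atomic. Irreducibles and units are those of
the subring. -/
def IsHereditarilyAtomicDomain (D : Type*) [CommRing D] : Prop :=
  IsDomain D ∧ ∀ S : Subring D, IsAtomicDomain S

/-- `R` is an algebraic field extension of the prime field `𝔽_p = ℤ/pℤ`. -/
def IsAlgebraicExtensionOfPrimeField (p : ℕ) (R : Type*) [CommRing R] : Prop :=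
  p.Prime ∧ IsField R ∧ ∃ _ : Algebra (ZMod p) R, Algebra.IsAlgebraic (ZMod p) R

/-! For necessity, a subring defined by conditions on each coefficient is not atomic once it has
monomials that split forever into nonunits (`not_isHereditarilyAtomicDomain`): by unique sums,
factors of monomials are monomials. If `R[G]` is a domain, `G` is torsion-free, so `R[ℤ]` embeds in
`R[G]`. Such subrings of `R[ℤ]` force every subring of `R` to be a field, so `R` is algebraic over
some `𝔽_p`. If `G` had rank at least two, `R[ℤ × ℤ] = R[ℤ][ℤ]` would make `R[ℤ]` a field; a
noncyclic group of rank one is dense in its order from `ℚ`, and positive monomials split forever.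

For sufficiency, a subring `S` of `R[ℤ]` is an `𝔽_p`-algebra and `R[ℤ]` is Noetherian, so infinite
descent of divisors in `S` could only come from monomials that are units of `R[ℤ]` but not of `S`.
Nonzero scalars are roots of unity, so a power of such a monomial is `y = x^N`. Algebraicity over
`𝔽_p[y]` bounds the monomial divisors of each nonzero element (`exists_natAbs_le_of_single_dvd`). -/

open AddMonoidAlgebra Function

/-! ### Transfer along embeddings -/

section Transfer

theorem IsAtomicDomain.of_ringEquiv {A B : Type*} [CommRing A] [CommRing B] (e : A ≃+* B)
    (hB : IsAtomicDomain B) : IsAtomicDomain A := by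
  obtain ⟨hdom, hfac⟩ := hB
  refine ⟨e.toMulEquiv.isDomain B, fun a ha hu => ?_⟩
  obtain ⟨s, hs, hprod⟩ := hfac (e a) (by simpa using ha) (by simpa using hu)
  refine ⟨s.map e.symm, fun b hb => ?_, ?_⟩
  · obtain ⟨c, hc, rfl⟩ := Multiset.mem_map.1 hb
    exact (MulEquiv.irreducible_iff e.symm).2 (hs c hc)
  · rw [← map_multiset_prod, hprod, e.symm_apply_apply]

/-- A ring that embeds into a hereditarily atomic domain is a hereditarily atomic domain. -/
theorem IsHereditarilyAtomicDomain.of_injective {A B : Type*} [CommRing A] [CommRing B]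
    (f : A →+* B) (hf : Injective f) (hB : IsHereditarilyAtomicDomain B) :
    IsHereditarilyAtomicDomain A := by
  obtain ⟨hdom, hat⟩ := hB
  exact ⟨hf.isDomain f, fun S => (hat (S.map f)).of_ringEquiv (S.equivMapOfInjective f hf)⟩

end Transfer

/-! ### Monomials and a criterion for non-atomic subrings -/

namespace AddMonoidAlgebra

variable {R : Type*} [CommRing R]

/-- The factors of a nonzero monomial are monomials. -/
theorem eq_single_of_mul_eq_single [IsDomain R] {G : Type*} [Add G] [TwoUniqueSums G]
    {f g : AddMonoidAlgebra R G} {t : G} {c : R} (hc : c ≠ 0) (h : f * g = single t c) :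
    ∃ a x b y, f = single a x ∧ g = single b y ∧ a + b = t ∧ x * y = c := by
  classical
  have hne : f * g ≠ 0 := by rw [h]; simpa using hc
  have hcoeff : ∀ a ∈ f.coeff.support, ∀ b ∈ g.coeff.support,
      UniqueAdd f.coeff.support g.coeff.support a b → a + b = t := by
    intro a ha b hb hab
    have := coeff_mul_add_of_uniqueAdd hab
    by_contra hne
    rw [h, coeff_single, Finsupp.single_apply, if_neg (Ne.symm hne)] at this
    exact mul_ne_zero (Finsupp.mem_support_iff.1 ha) (Finsupp.mem_support_iff.1 hb) this.symm
  have hcard : f.coeff.support.card * g.coeff.support.card ≤ 1 := by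
    by_contra! hlt
    obtain ⟨p, hp, q, hq, hpq, hup, huq⟩ := TwoUniqueSums.uniqueAdd_of_one_lt_card hlt
    rw [Finset.mem_product] at hp hq
    have := huq hp.1 hp.2 ((hcoeff _ hp.1 _ hp.2 hup).trans (hcoeff _ hq.1 _ hq.2 huq).symm)
    exact hpq (Prod.ext this.1 this.2)
  have hf : f.coeff.support.card ≠ 0 := by
    intro h0
    rw [Finset.card_eq_zero, Finsupp.support_eq_empty, coeff_eq_zero] at h0
    simp [h0] at hne
  have hg : g.coeff.support.card ≠ 0 := by
    intro h0
    rw [Finset.card_eq_zero, Finsupp.support_eq_empty, coeff_eq_zero] at h0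
    simp [h0] at hne
  have hf1 : f.coeff.support.card = 1 :=
    le_antisymm ((Nat.le_mul_of_pos_right _ (Nat.pos_of_ne_zero hg)).trans hcard)
      (Nat.pos_of_ne_zero hf)
  have hg1 : g.coeff.support.card = 1 :=
    le_antisymm ((Nat.le_mul_of_pos_left _ (Nat.pos_of_ne_zero hf)).trans hcard)
      (Nat.pos_of_ne_zero hg)
  obtain ⟨a, x, hx, hfa⟩ := Finsupp.card_support_eq_one'.1 hf1
  obtain ⟨b, y, hy, hgb⟩ := Finsupp.card_support_eq_one'.1 hg1
  have hfs : f = single a x := coeff_injective hfa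
  have hgs : g = single b y := coeff_injective hgb
  subst hfs hgs
  rw [single_mul_single, single_inj] at h
  rcases h with h | h
  · exact ⟨a, x, b, y, rfl, rfl, h.1, h.2⟩
  · exact absurd h.2 hc

variable {G : Type*} [AddCommGroup G]

/-- The subring of elements whose coefficients lie in a multiplicative family of additive
subgroups. -/
def coeffSubring (A : G → AddSubgroup R) (one_mem : 1 ∈ A 0)
    (mul_mem : ∀ g h a b, a ∈ A g → b ∈ A h → a * b ∈ A (g + h)) :
    Subring (AddMonoidAlgebra R G) where
  carrier := {f | ∀ g, f.coeff g ∈ A g}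
  mul_mem' {x y} hx hy g := by
    classical
    rw [coeff_mul, Finsupp.sum]
    refine sum_mem fun a _ => ?_
    rw [Finsupp.sum]
    refine sum_mem fun b _ => ?_
    split_ifs with hab
    · exact hab ▸ mul_mem _ _ _ _ (hx a) (hy b)
    · exact zero_mem _
  one_mem' g := by
    classical
    rw [one_def, coeff_single, Finsupp.single_apply]
    split_ifs with hg
    · exact hg ▸ one_mem
    · exact zero_mem _
  add_mem' {x y} hx hy g := by simpa using add_mem (hx g) (hy g)
  zero_mem' g := by simp
  neg_mem' {x} hx g := by simpa using hx g

theorem mem_coeffSubring {A : G → AddSubgroup R} {h1 hm} {f : AddMonoidAlgebra R G} :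
    f ∈ coeffSubring A h1 hm ↔ ∀ g, f.coeff g ∈ A g := Iff.rfl

theorem single_mem_coeffSubring {A : G → AddSubgroup R} {h1 hm} {g : G} {c : R} :
    single g c ∈ coeffSubring A h1 hm ↔ c ∈ A g := by
  classical
  rw [mem_coeffSubring]
  refine ⟨fun h => by simpa using h g, fun h k => ?_⟩
  rw [coeff_single, Finsupp.single_apply]
  split_ifs with hg
  · exact hg ▸ h
  · exact zero_mem _

/-- A subring of a group algebra cut out by coefficient conditions is not atomic if it has a
nonempty set of monomials, each of which is a product of two nonunits, such that a product
of monomials in the set has a factor in the set. -/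
theorem not_isHereditarilyAtomicDomain [IsDomain R] [TwoUniqueSums G] (A : G → AddSubgroup R)
    (one_mem : 1 ∈ A 0) (mul_mem : ∀ g h a b, a ∈ A g → b ∈ A h → a * b ∈ A (g + h))
    (T : G → R → Prop) {g₀ : G} {c₀ : R} (h₀ : T g₀ c₀) (hne : ∀ g c, T g c → c ≠ 0)
    (hsplit : ∀ g c, T g c → ∃ g₁ c₁ g₂ c₂, g₁ + g₂ = g ∧ c₁ * c₂ = c ∧ c₁ ∈ A g₁ ∧ c₂ ∈ A g₂ ∧
      (∀ d ∈ A (-g₁), c₁ * d ≠ 1) ∧ (∀ d ∈ A (-g₂), c₂ * d ≠ 1))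
    (hprime : ∀ g a h b, a ∈ A g → b ∈ A h → T (g + h) (a * b) → T g a ∨ T h b) :
    ¬ IsHereditarilyAtomicDomain (AddMonoidAlgebra R G) := by
  rintro ⟨-, hat⟩
  set S := coeffSubring A one_mem mul_mem
  have nonunit : ∀ (g : G) (c : R) (hc : c ∈ A g), (∀ d ∈ A (-g), c * d ≠ 1) →
      ¬ IsUnit (⟨single g c, single_mem_coeffSubring.2 hc⟩ : S) := by
    intro g c hc hd hu
    obtain ⟨v, hv⟩ := hu.exists_right_inv
    have hv' := congrArg Subtype.val hv
    simp only [Subring.coe_mul, Subring.coe_one] at hv'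
    rw [one_def] at hv'
    obtain ⟨a, x, b, y, hax, hby, hab, hxy⟩ := eq_single_of_mul_eq_single one_ne_zero hv'
    have hx0 : x ≠ 0 := left_ne_zero_of_mul (hxy ▸ one_ne_zero)
    rcases single_inj.1 hax with ⟨rfl, rfl⟩ | h
    · obtain rfl : b = -g := (neg_eq_of_add_eq_zero_right hab).symm
      have := v.2
      rw [hby] at this
      exact hd y (single_mem_coeffSubring.1 this) hxy
    · exact hx0 h.2
  have split : ∀ (b : S) (g : G) (c : R), T g c → (b : AddMonoidAlgebra R G) = single g c →
      ∃ u v : S, b = u * v ∧ ¬ IsUnit u ∧ ¬ IsUnit v := by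
    intro b g c hT hb
    obtain ⟨g₁, c₁, g₂, c₂, hg, hc, h₁, h₂, hu₁, hu₂⟩ := hsplit g c hT
    refine ⟨_, _, Subtype.ext ?_, nonunit g₁ c₁ h₁ hu₁, nonunit g₂ c₂ h₂ hu₂⟩
    rw [hb, Subring.coe_mul, single_mul_single, hg, hc]
  have key : ∀ (s : Multiset S) (g : G) (c : R), T g c →
      (s.prod : AddMonoidAlgebra R G) = single g c →
      ∃ b ∈ s, ∃ g c, T g c ∧ (b : AddMonoidAlgebra R G) = single g c := by
    intro s
    induction s using Multiset.induction_on with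
    | empty =>
      intro g c hT h
      obtain ⟨u, v, huv, hu, -⟩ := split _ g c hT h
      exact absurd (IsUnit.of_mul_eq_one _ huv.symm) hu
    | cons a s ih =>
      intro g c hT h
      rw [Multiset.prod_cons, Subring.coe_mul] at h
      obtain ⟨g₁, c₁, g₂, c₂, ha, hs, rfl, rfl⟩ := eq_single_of_mul_eq_single (hne g c hT) h
      have h₁ : c₁ ∈ A g₁ := single_mem_coeffSubring.1 (ha ▸ a.2)
      have h₂ : c₂ ∈ A g₂ := single_mem_coeffSubring.1 (hs ▸ s.prod.2)
      rcases hprime _ _ _ _ h₁ h₂ hT with h | h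
      · exact ⟨a, Multiset.mem_cons_self a s, g₁, c₁, h, ha⟩
      · obtain ⟨b, hb, hbT⟩ := ih g₂ c₂ h hs
        exact ⟨b, Multiset.mem_cons_of_mem hb, hbT⟩
  obtain ⟨g₁, c₁, g₂, c₂, hg, hc, h₁, h₂, -, -⟩ := hsplit g₀ c₀ h₀
  have hmem : c₀ ∈ A g₀ := hg ▸ hc ▸ mul_mem _ _ _ _ h₁ h₂
  let t : S := ⟨single g₀ c₀, single_mem_coeffSubring.2 hmem⟩
  have htu : ¬ IsUnit t := by
    obtain ⟨u, v, huv, hu, -⟩ := split t g₀ c₀ h₀ rfl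
    intro ht
    rw [huv] at ht
    exact hu (isUnit_of_mul_isUnit_left ht)
  have ht0 : t ≠ 0 := fun h => hne g₀ c₀ h₀ (by simpa [t] using congrArg Subtype.val h)
  obtain ⟨s, hs, hprod⟩ := (hat S).2 t ht0 htu
  obtain ⟨b, hb, g, c, hT, hbg⟩ := key s g₀ c₀ h₀ (congrArg Subtype.val hprod)
  obtain ⟨u, v, huv, hu, hv⟩ := split b g c hT hbg
  exact ((hs b hb).isUnit_or_isUnit huv).elim hu hv

end AddMonoidAlgebra

/-! ### Necessity: the coefficient ring -/

namespace AddMonoidAlgebra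

variable {R : Type*} [CommRing R] [IsDomain R]

/-- For a nonzero prime `P`, allow only coefficients in `P` at negative exponents. Then `x` is a
nonunit, and `c x^g = x * (c x^(g-1))` splits forever for nonzero `c ∈ P`. -/
theorem isField_of_isHereditarilyAtomicDomain_int
    (h : IsHereditarilyAtomicDomain (AddMonoidAlgebra R ℤ)) : IsField R := by
  by_contra hR
  obtain ⟨P, hP0, hP⟩ := Ring.not_isField_iff_exists_prime.1 hR
  obtain ⟨r, hrP, hr0⟩ := P.ne_bot_iff.1 hP0
  let A : ℤ → AddSubgroup R := fun k => if 0 ≤ k then ⊤ else P.toAddSubgroup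
  have hA : ∀ k c, c ∈ A k ↔ 0 ≤ k ∨ c ∈ P := by
    intro k c
    by_cases hk : 0 ≤ k <;> simp [A, hk]
  have one_notMem : (1 : R) ∉ P := (Ideal.ne_top_iff_one P).1 hP.ne_top
  refine not_isHereditarilyAtomicDomain A (by simp [hA]) ?_ (fun _ c => c ≠ 0 ∧ c ∈ P)
    (g₀ := 0) (c₀ := r) ⟨hr0, hrP⟩ (fun _ _ hT => hT.1) ?_ ?_ h
  · intro g h a b ha hb
    rw [hA] at ha hb ⊢
    rcases ha with ha | ha
    · rcases hb with hb | hb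
      · exact Or.inl (add_nonneg ha hb)
      · exact Or.inr (P.mul_mem_left _ hb)
    · exact Or.inr (P.mul_mem_right _ ha)
  · rintro g c ⟨hc0, hcP⟩
    refine ⟨1, 1, g - 1, c, by ring, by ring, by simp [hA], by simp [hA, hcP], ?_, ?_⟩
    · intro d hd h1
      rw [hA] at hd
      rw [one_mul] at h1
      rcases hd with hd | hd
      · omega
      · exact one_notMem (h1 ▸ hd)
    · intro d _ h1
      exact one_notMem (h1 ▸ P.mul_mem_right _ hcP)
  · rintro g a h b - - ⟨h0, hP'⟩
    rcases hP.mem_or_mem hP' with h | h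
    · exact Or.inl ⟨left_ne_zero_of_mul h0, h⟩
    · exact Or.inr ⟨right_ne_zero_of_mul h0, h⟩

/-- In `B + x R[x]`, a nonunit `a` of `B` that is invertible in `R` can be extracted from `c x^g`,
`g > 0`, without end. -/
theorem isField_subring_of_isHereditarilyAtomicDomain_int
    (h : IsHereditarilyAtomicDomain (AddMonoidAlgebra R ℤ)) (B : Subring R) : IsField B := by
  refine ⟨⟨0, 1, zero_ne_one⟩, mul_comm, ?_⟩
  intro a ha
  by_contra hinv
  have hinv' : ∀ d ∈ B, (a : R) * d ≠ 1 := fun d hd h1 => hinv ⟨⟨d, hd⟩, Subtype.ext h1⟩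
  have ha0 : (a : R) ≠ 0 := by simpa using ha
  obtain ⟨a', ha'⟩ := (isField_of_isHereditarilyAtomicDomain_int h).mul_inv_cancel ha0
  let A : ℤ → AddSubgroup R := fun k =>
    if 0 < k then ⊤ else if k = 0 then B.toAddSubgroup else ⊥
  have hA : ∀ k c, c ∈ A k ↔ 0 < k ∨ (k = 0 ∧ c ∈ B) ∨ c = 0 := by
    intro k c
    by_cases hk : 0 < k
    · simp [A, hk]
    · by_cases hk0 : k = 0
      · subst hk0
        have : c = 0 → c ∈ B := fun h => h ▸ B.zero_mem
        simpa [A] using this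
      · simp [A, hk, hk0]
  refine not_isHereditarilyAtomicDomain A (by simp [hA, B.one_mem]) ?_
    (fun k c => 0 < k ∧ c ≠ 0) (g₀ := 1) (c₀ := 1) (by simp) (fun _ _ hT => hT.2) ?_ ?_ h
  · intro g h a b ha hb
    rw [hA] at ha hb ⊢
    rcases ha with ha | ⟨rfl, ha⟩ | rfl
    · rcases hb with hb | ⟨rfl, hb⟩ | rfl
      · left; omega
      · left; omega
      · simp
    · rcases hb with hb | ⟨rfl, hb⟩ | rfl
      · left; omega
      · exact Or.inr (Or.inl ⟨by simp, B.mul_mem ha hb⟩)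
      · simp
    · simp
  · rintro g c ⟨hg, hc⟩
    refine ⟨0, a, g, a' * c, by ring, by rw [← mul_assoc, ha', one_mul], by simp [hA],
      by simp [hA, hg], ?_, ?_⟩
    · intro d hd
      refine hinv' d ?_
      simp only [hA, neg_zero, lt_self_iff_false, true_and, false_or] at hd
      exact hd.elim id fun h => h ▸ B.zero_mem
    · intro d hd h1
      rw [hA] at hd
      rcases hd with hd | hd | rfl
      · omega
      · omega
      · simp at h1
  · rintro g a h b ha hb ⟨hgh, hab⟩
    by_cases hg : 0 < g
    · exact Or.inl ⟨hg, left_ne_zero_of_mul hab⟩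
    · refine Or.inr ⟨?_, right_ne_zero_of_mul hab⟩
      rw [hA] at ha
      rcases ha with ha | ha | rfl
      · omega
      · omega
      · simp at hab

theorem not_isHereditarilyAtomicDomain_of_denselyOrdered {G : Type*} [AddCommGroup G]
    [LinearOrder G] [IsOrderedAddMonoid G] [DenselyOrdered G] [Nontrivial G] :
    ¬ IsHereditarilyAtomicDomain (AddMonoidAlgebra R G) := by
  classical
  obtain ⟨t, ht⟩ := exists_zero_lt (α := G)
  let A : G → AddSubgroup R := fun k => if 0 ≤ k then ⊤ else ⊥
  have hA : ∀ k c, c ∈ A k ↔ 0 ≤ k ∨ c = 0 := by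
    intro k c
    by_cases hk : 0 ≤ k <;> simp [A, hk]
  have nonunit : ∀ g : G, 0 < g → ∀ c, ∀ d ∈ A (-g), c * d ≠ 1 := by
    intro g hg c d hd h1
    rw [hA] at hd
    rcases hd with hd | rfl
    · exact absurd (neg_nonneg.1 hd) (not_le.2 hg)
    · simp at h1
  refine not_isHereditarilyAtomicDomain A (by simp [hA]) ?_ (fun k c => 0 < k ∧ c ≠ 0)
    (g₀ := t) (c₀ := 1) ⟨ht, one_ne_zero⟩ (fun _ _ hT => hT.2) ?_ ?_
  · intro g h a b ha hb
    rw [hA] at ha hb ⊢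
    rcases ha with ha | rfl
    · rcases hb with hb | rfl
      · exact Or.inl (add_nonneg ha hb)
      · simp
    · simp
  · rintro g c ⟨hg, hc⟩
    obtain ⟨s, hs0, hsg⟩ := exists_between hg
    exact ⟨s, 1, g - s, c, by abel, one_mul c, (hA _ _).2 (Or.inl hs0.le),
      (hA _ _).2 (Or.inl (sub_pos.2 hsg).le), nonunit s hs0 1, nonunit _ (sub_pos.2 hsg) c⟩
  · rintro g a h b ha hb ⟨hgh, hab⟩
    by_cases hg : 0 < g
    · exact Or.inl ⟨hg, left_ne_zero_of_mul hab⟩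
    · refine Or.inr ⟨?_, right_ne_zero_of_mul hab⟩
      by_contra hh
      exact absurd (add_nonpos (not_lt.1 hg) (not_lt.1 hh)) (not_le.2 hgh)

theorem not_isField_int : ¬ IsField (AddMonoidAlgebra R ℤ) := by
  intro hF
  have hne : (single 0 1 + single 1 1 : AddMonoidAlgebra R ℤ) ≠ 0 := by
    intro h
    have := congrArg (fun f => f.coeff 0) h
    simp at this
  obtain ⟨v, hv⟩ := hF.mul_inv_cancel hne
  rw [one_def] at hv
  obtain ⟨a, x, b, y, h, -⟩ := eq_single_of_mul_eq_single one_ne_zero hv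
  have h0 := congrArg (fun f => f.coeff 0) h
  have h1 := congrArg (fun f => f.coeff 1) h
  simp only [coeff_add, coeff_single, Finsupp.add_apply, Finsupp.single_apply] at h0 h1
  by_cases ha : a = 0
  · subst ha; simp at h1
  · simp [ha] at h0

/-- An element of finite order `n` gives zero divisors: `(x^g - 1)(1 + x^g + ⋯ + x^((n-1)g)) = 0`.
-/
theorem isAddTorsionFree_of_isDomain {G : Type*} [AddCommGroup G]
    (hdom : IsDomain (AddMonoidAlgebra R G)) : IsAddTorsionFree G := by
  classical
  rw [isAddTorsionFree_iff_not_isOfFinAddOrder]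
  intro g hg hfin
  have hpos : 0 < addOrderOf g := hfin.addOrderOf_pos
  have hne : (single g 1 - 1 : AddMonoidAlgebra R G) ≠ 0 := by
    rw [sub_ne_zero, one_def, Ne, single_left_inj one_ne_zero]
    exact hg
  have hmul := geom_sum_mul (single g 1 : AddMonoidAlgebra R G) (addOrderOf g)
  rw [single_pow, addOrderOf_nsmul_eq_zero, one_pow, ← one_def, sub_self] at hmul
  have h0 := congrArg (fun f => f.coeff 0) ((mul_eq_zero.1 hmul).resolve_right hne)
  simp only [coeff_sum, single_pow, one_pow, coeff_single, Finsupp.finsetSum_apply,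
    Finsupp.single_apply, coeff_zero, Finsupp.zero_apply] at h0
  rw [Finset.sum_eq_single_of_mem 0 (Finset.mem_range.2 hpos)] at h0
  · simp at h0
  · intro i hi hi0
    rw [if_neg]
    exact fun h => hi0 (Nat.eq_zero_of_dvd_of_lt (addOrderOf_dvd_of_nsmul_eq_zero h)
      (Finset.mem_range.1 hi))

theorem exists_isAlgebraicExtensionOfPrimeField_of_isHereditarilyAtomicDomain_int
    (h : IsHereditarilyAtomicDomain (AddMonoidAlgebra R ℤ)) :
    ∃ p : ℕ, IsAlgebraicExtensionOfPrimeField p R := by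
  obtain ⟨p, hp⟩ := CharP.exists R
  have hp0 : p ≠ 0 := by
    rintro rfl
    have := CharP.charP_to_charZero R
    have hF := isField_subring_of_isHereditarilyAtomicDomain_int h (Int.castRingHom R).range
    obtain ⟨⟨b, n, hn⟩, hb⟩ := hF.mul_inv_cancel (a := ⟨2, 2, by simp⟩)
      (fun h0 => two_ne_zero (congrArg Subtype.val h0 : (2 : R) = 0))
    have hb' : (2 : R) * b = 1 := congrArg Subtype.val hb
    rw [← hn, eq_intCast] at hb'
    have : (2 : ℤ) * n = 1 := by exact_mod_cast hb'
    omega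
  have hprime : p.Prime := (CharP.char_is_prime_or_zero R p).resolve_right hp0
  have : Fact p.Prime := ⟨hprime⟩
  let alg : Algebra (ZMod p) R := ZMod.algebra R p
  refine ⟨p, hprime, isField_of_isHereditarilyAtomicDomain_int h, alg, ⟨fun r => ?_⟩⟩
  by_cases hr : r = 0
  · exact hr ▸ isAlgebraic_zero
  have hF := isField_subring_of_isHereditarilyAtomicDomain_int h
    (Algebra.adjoin (ZMod p) {r}).toSubring
  obtain ⟨⟨s, hs⟩, hrs⟩ := hF.mul_inv_cancel (a := ⟨r, Algebra.self_mem_adjoin_singleton _ r⟩)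
    (fun h0 => hr (congrArg Subtype.val h0))
  have hrs' : r * s = 1 := congrArg Subtype.val hrs
  rw [Subalgebra.mem_toSubring, Algebra.adjoin_singleton_eq_range_aeval] at hs
  obtain ⟨q, hq⟩ := hs
  -- The inverse of `r` lies in `𝔽_p[r]`, so it is `q(r)`, and `r q(r) = 1` is an algebraic
  -- relation.
  refine ⟨Polynomial.X * q - 1, fun h0 => ?_, ?_⟩
  · have := congrArg (fun f => Polynomial.coeff f 0) h0
    simp at this
  · have hq' : Polynomial.aeval r q = s := hq
    simp [hq', hrs']

end AddMonoidAlgebra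

/-! ### Necessity: the group -/

/-- A torsion-free abelian group of rank one embeds into `ℚ`. -/
theorem exists_injective_addMonoidHom_rat {G : Type*} [AddCommGroup G] [IsAddTorsionFree G] {g : G}
    (hg : g ≠ 0) (h : ∀ x : G, ∃ b : ℤ, b ≠ 0 ∧ ∃ a : ℤ, b • x = a • g) :
    ∃ φ : G →+ ℚ, Injective φ := by
  choose n hn m hm using h
  -- The fraction does not depend on the chosen relation, which makes the map additive.
  have key : ∀ (x : G) (b a : ℤ), b ≠ 0 → b • x = a • g → (m x / n x : ℚ) = a / b := by
    intro x b a hb hx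
    have h1 : (b * m x) • g = (a * n x) • g := by
      rw [mul_smul, ← hm, mul_comm a, mul_smul, ← hx, smul_comm]
    have h2 : b * m x = a * n x := smul_left_injective ℤ hg h1
    have h3 : (b * m x : ℚ) = a * n x := by exact_mod_cast h2
    have hn' : (n x : ℚ) ≠ 0 := by exact_mod_cast hn x
    have hb' : (b : ℚ) ≠ 0 := by exact_mod_cast hb
    rw [div_eq_div_iff hn' hb', ← h3, mul_comm]
  refine ⟨AddMonoidHom.mk' (fun x => (m x / n x : ℚ)) fun x y => ?_, ?_⟩
  · rw [key (x + y) (n x * n y) (n y * m x + n x * m y) (mul_ne_zero (hn x) (hn y))]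
    · have hx : (n x : ℚ) ≠ 0 := by exact_mod_cast hn x
      have hy : (n y : ℚ) ≠ 0 := by exact_mod_cast hn y
      push_cast
      field_simp
    · rw [smul_add, mul_comm, mul_smul, hm, mul_comm, mul_smul (n x), hm, add_smul, mul_smul,
        mul_smul]
  · rw [injective_iff_map_eq_zero]
    intro x hx
    have hx' : (m x / n x : ℚ) = 0 := hx
    have hm0 : m x = 0 := by
      have hn' : (n x : ℚ) ≠ 0 := by exact_mod_cast hn x
      simpa [hn'] using hx'
    have := hm x
    rw [hm0, zero_smul] at this
    exact (smul_eq_zero.1 this).resolve_left (hn x)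

namespace AddMonoidAlgebra

variable {R : Type*} [CommRing R] {G : Type*} [AddCommGroup G]

theorem _root_.IsHereditarilyAtomicDomain.of_injective_addMonoidHom {H : Type*} [AddCommGroup H]
    (φ : H →+ G) (hφ : Injective φ) (h : IsHereditarilyAtomicDomain (AddMonoidAlgebra R G)) :
    IsHereditarilyAtomicDomain (AddMonoidAlgebra R H) :=
  h.of_injective (mapDomainRingHom R φ) (mapDomain_injective hφ)

theorem isAddCyclic_of_isHereditarilyAtomicDomain [IsDomain R] [Nontrivial G] [IsAddTorsionFree G]
    (h : IsHereditarilyAtomicDomain (AddMonoidAlgebra R G)) : IsAddCyclic G := by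
  obtain ⟨g, hg⟩ := exists_ne (0 : G)
  have hrank : ∀ x : G, ∃ b : ℤ, b ≠ 0 ∧ ∃ a : ℤ, b • x = a • g := by
    intro x
    by_contra! hx
    let φ : ℤ × ℤ →+ G :=
      ((zmultiplesHom G) g).coprod ((zmultiplesHom G) x)
    have hφ : Injective φ := by
      rw [injective_iff_map_eq_zero]
      rintro ⟨a, b⟩ hab
      have hab' : a • g + b • x = 0 := by simpa [φ] using hab
      have hb : b = 0 := by
        by_contra hb
        refine hx b hb (-a) ?_
        rw [neg_smul, eq_neg_iff_add_eq_zero, add_comm, hab']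
      subst hb
      have ha : a = 0 := by simpa [hg] using hab'
      rw [ha]; rfl
    have h2 := (h.of_injective_addMonoidHom φ hφ).of_injective
      (curryRingEquiv (R := R) (M := ℤ) (N := ℤ)).symm.toRingHom (RingEquiv.injective _)
    exact not_isField_int (isField_of_isHereditarilyAtomicDomain_int h2)
  obtain ⟨φ, hφ⟩ := exists_injective_addMonoidHom_rat hg hrank
  let e : G ≃+ φ.range := AddMonoidHom.ofInjective hφ
  rcases LinearOrderedAddCommGroup.discrete_or_denselyOrdered φ.range with ⟨⟨i⟩⟩ | hd
  · exact isAddCyclic_of_surjective (e.trans i.toAddEquiv).symm (AddEquiv.surjective _)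
  · have : Nontrivial φ.range := e.symm.toEquiv.nontrivial
    exact absurd (h.of_injective_addMonoidHom e.symm.toAddMonoidHom e.symm.injective)
      not_isHereditarilyAtomicDomain_of_denselyOrdered

end AddMonoidAlgebra

/-! ### Sufficiency: ascending chain condition on principal ideals -/

/-- In an algebraic extension domain of a finite field every nonzero element has finite order. -/
theorem isOfFinOrder_of_isAlgebraic (F : Type*) {R : Type*} [Field F] [Finite F] [CommRing R]
    [IsDomain R] [Algebra F R] [Algebra.IsAlgebraic F R] {c : R} (hc : c ≠ 0) :
    IsOfFinOrder c := by
  have hint : IsIntegral F c := (Algebra.IsAlgebraic.isAlgebraic c).isIntegral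
  have : Module.Finite F (Algebra.adjoin F {c}) :=
    Module.Finite.iff_fg.2 hint.fg_adjoin_singleton
  have : Finite (Algebra.adjoin F {c}) := Module.finite_of_finite F
  let c' : Algebra.adjoin F {c} := ⟨c, Algebra.self_mem_adjoin_singleton F c⟩
  obtain ⟨i, j, hij, h⟩ := Finite.exists_ne_map_eq_of_infinite fun n : ℕ => c' ^ n
  have h' : c ^ i = c ^ j := congrArg Subtype.val h
  wlog hlt : i < j generalizing i j
  · exact this j i hij.symm h.symm h'.symm (lt_of_le_of_ne (not_lt.1 hlt) hij.symm)
  refine isOfFinOrder_iff_pow_eq_one.2 ⟨j - i, Nat.sub_pos_of_lt hlt, ?_⟩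
  have : c ^ i * c ^ (j - i) = c ^ i * 1 := by
    rw [← pow_add, Nat.add_sub_cancel' hlt.le, h', mul_one]
  exact mul_left_cancel₀ (pow_ne_zero i hc) this

/-- A subring of a domain in which divisibility is well founded inherits this property if there is
a measure that grows strictly under multiplication by nonunits that become units. -/
theorem Subring.wfDvdMonoid_of_measure {D : Type*} [CommRing D] [IsDomain D] [WfDvdMonoid D]
    (S : Subring D) (μ : S → ℕ)
    (hμ : ∀ f g : S, f * g ≠ 0 → ¬ IsUnit g → IsUnit (g : D) → μ f < μ (f * g)) :
    WfDvdMonoid S := by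
  -- A proper divisor in `S` is either proper in `D`, or associated in `D` and of smaller measure.
  have hwf : WellFounded (Prod.Lex (DvdNotUnit (α := Associates D)) (· < · : ℕ → ℕ → Prop)) :=
    WellFounded.prod_lex wellFounded_dvdNotUnit wellFounded_lt
  have hstep : ∀ f g : S, g ≠ 0 → DvdNotUnit f g →
      Prod.Lex (DvdNotUnit (α := Associates D)) (· < · : ℕ → ℕ → Prop)
        (Associates.mk (f : D), μ f) (Associates.mk (g : D), μ g) := by
    rintro f _ hg ⟨hf, x, hx, rfl⟩
    have hf' : (f : D) ≠ 0 := by simpa using hf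
    by_cases hxu : IsUnit (x : D)
    · have : Associates.mk ((f * x : S) : D) = Associates.mk (f : D) := by
        rw [Associates.mk_eq_mk_iff_associated, Subring.coe_mul]
        exact (associated_mul_unit_right _ _ hxu).symm
      rw [this]
      exact Prod.Lex.right _ (hμ f x hg hx hxu)
    · refine Prod.Lex.left _ _ ⟨?_, Associates.mk (x : D), ?_, ?_⟩
      · rwa [Ne, Associates.mk_eq_zero]
      · rwa [Associates.isUnit_mk]
      · rw [Subring.coe_mul, Associates.mk_mul_mk]
  have hacc : ∀ f : S, f ≠ 0 → Acc DvdNotUnit f := by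
    intro f
    induction h : (Associates.mk (f : D), μ f) using hwf.induction generalizing f with
    | _ _ ih =>
      subst h
      intro hf
      exact Acc.intro _ fun g hg => ih _ (hstep g f hf hg) g rfl hg.1
  refine ⟨⟨fun f => ?_⟩⟩
  by_cases hf : f = 0
  · subst hf
    exact Acc.intro _ fun g hg => hacc g hg.1
  · exact hacc f hf

namespace AddMonoidAlgebra

variable {R : Type*} [CommRing R] [IsDomain R]

theorem wfDvdMonoid_int (hR : IsField R) : WfDvdMonoid (AddMonoidAlgebra R ℤ) := by
  let := hR.toField
  have : IsNoetherianRing R := inferInstance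
  have : IsNoetherianRing (LaurentPolynomial R) :=
    IsLocalization.isNoetherianRing (Submonoid.powers (Polynomial.X : Polynomial R))
      (LaurentPolynomial R) inferInstance
  exact IsNoetherianRing.wfDvdMonoid (R := LaurentPolynomial R)

/-- A Laurent polynomial ring over an algebraic extension of a field `F` is algebraic over the
subring generated by `F` and a nonconstant monomial. -/
theorem isAlgebraic_adjoin_single {F : Type*} [Field F] [Algebra F R]
    (hfin : ∀ c : R, c ≠ 0 → IsOfFinOrder c) {N : ℤ} (hN : N ≠ 0) (f : AddMonoidAlgebra R ℤ) :
    IsAlgebraic (Algebra.adjoin F {(single N 1 : AddMonoidAlgebra R ℤ)}) f := by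
  set A := Algebra.adjoin F {(single N 1 : AddMonoidAlgebra R ℤ)}
  let y : A := ⟨single N 1, Algebra.self_mem_adjoin_singleton F _⟩
  have hy0 : y ≠ 0 := fun h =>
    one_ne_zero (single_eq_zero.1 (congrArg Subtype.val h : single N (1 : R) = 0))
  induction f using AddMonoidAlgebra.induction_linear with
  | zero => exact isAlgebraic_zero
  | add f g hf hg => exact hf.add hg
  | single a c =>
    by_cases hc : c = 0
    · rw [hc, single_zero]; exact isAlgebraic_zero
    obtain ⟨m, hm, hcm⟩ := (isOfFinOrder_iff_pow_eq_one).1 (hfin c hc)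
    -- This power turns the coefficient into 1 and the exponent into a multiple of `N`.
    refine IsAlgebraic.of_pow (n := m * N.natAbs) (Nat.mul_pos hm (Int.natAbs_pos.2 hN)) ?_
    rw [single_pow, pow_mul, hcm, one_pow]
    obtain ⟨z, hz⟩ : ∃ z : ℤ, (m * N.natAbs) • a = z * N := by
      rcases Int.natAbs_eq N with h | h
      · exact ⟨m * a, by rw [nsmul_eq_mul]; push_cast; rw [← Int.natCast_natAbs, mul_right_comm, ← h]⟩
      · refine ⟨-(m * a), ?_⟩
        conv_rhs => rw [h]
        rw [nsmul_eq_mul]; push_cast; ring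
    rw [hz]
    obtain ⟨n, rfl | rfl⟩ := z.eq_nat_or_neg
    · have : (single (n * N) 1 : AddMonoidAlgebra R ℤ) = algebraMap A _ (y ^ n) := by
        rw [map_pow]
        change _ = (single N 1 : AddMonoidAlgebra R ℤ) ^ n
        rw [single_pow, one_pow, nsmul_eq_mul]
      rw [this]
      exact isAlgebraic_algebraMap _
    · refine ⟨Polynomial.C (y ^ n) * Polynomial.X - 1, fun h => ?_, ?_⟩
      · have := congrArg (fun q => Polynomial.coeff q 0) h
        simp at this
      · have : algebraMap A (AddMonoidAlgebra R ℤ) y = single N 1 := rfl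
        rw [map_sub, map_mul, Polynomial.aeval_C, Polynomial.aeval_X, map_pow, this, single_pow,
          single_mul_single, map_one, sub_eq_zero, one_def]
        simp

end AddMonoidAlgebra

namespace AddMonoidAlgebra

variable {R : Type*} [CommRing R]

/-- With exponents of opposite sign, suitable positive powers of the two monomials multiply to 1,
making `x^N` a unit of `S`. -/
theorem nonneg_mul_of_single_mem (hfin : ∀ c : R, c ≠ 0 → IsOfFinOrder c)
    {S : Subring (AddMonoidAlgebra R ℤ)} {N : ℤ} (hy : single N 1 ∈ S)
    (hyu : ∀ v ∈ S, single N 1 * v ≠ 1) {a : ℤ} {d : R} (hd : d ≠ 0) (ha : single a d ∈ S) :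
    0 ≤ a * N := by
  by_contra! hneg
  obtain ⟨m, hm, hdm⟩ := isOfFinOrder_iff_pow_eq_one.1 (hfin d hd)
  have ha0 : a ≠ 0 := by rintro rfl; simp at hneg
  have hk : 0 < m * a.natAbs := Nat.mul_pos hm (Int.natAbs_pos.2 ha0)
  have hexp : a.natAbs * N + N.natAbs * a = 0 := by
    rcases mul_neg_iff.1 hneg with ⟨h1, h2⟩ | ⟨h1, h2⟩
    · rw [Int.natCast_natAbs, Int.natCast_natAbs, abs_of_pos h1, abs_of_neg h2]; ring
    · rw [Int.natCast_natAbs, Int.natCast_natAbs, abs_of_neg h1, abs_of_pos h2]; ring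
  have h1 : (single N 1 : AddMonoidAlgebra R ℤ) ^ (m * a.natAbs) *
      single a d ^ (m * N.natAbs) = 1 := by
    rw [single_pow, single_pow, single_mul_single, one_pow, pow_mul d, hdm, one_pow, mul_one,
      one_def]
    congr 1
    rw [nsmul_eq_mul, nsmul_eq_mul]
    push_cast
    rw [mul_assoc, mul_assoc, ← mul_add, ← Int.natCast_natAbs, ← Int.natCast_natAbs, hexp, mul_zero]
  refine hyu (single N 1 ^ (m * a.natAbs - 1) * single a d ^ (m * N.natAbs))
    (S.mul_mem (S.pow_mem hy _) (S.pow_mem ha _)) ?_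
  rw [← mul_assoc, mul_pow_sub_one hk.ne', h1]

/-- In an algebra of Laurent polynomials containing a nonconstant nonunit monomial, the monomial
divisors of a nonzero element have bounded degree. -/
theorem exists_natAbs_le_of_single_dvd [IsDomain R] {F : Type*} [Field F] [Algebra F R]
    (hfin : ∀ c : R, c ≠ 0 → IsOfFinOrder c) (S : Subalgebra F (AddMonoidAlgebra R ℤ)) {N : ℤ}
    (hN : N ≠ 0) (hy : single N 1 ∈ S) (hyu : ∀ v ∈ S, single N 1 * v ≠ 1)
    {f : AddMonoidAlgebra R ℤ} (hf : f ∈ S) (hf0 : f ≠ 0) :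
    ∃ B : ℕ, ∀ a d, d ≠ 0 → single a d ∈ S → (∃ h ∈ S, f = single a d * h) → a.natAbs ≤ B := by
  set y : AddMonoidAlgebra R ℤ := single N 1 with hy_def
  have hy0 : y ≠ 0 := fun h => one_ne_zero (single_eq_zero.1 h)
  have hAS : Algebra.adjoin F {y} ≤ S := Algebra.adjoin_le (by simpa using hy)
  -- Some multiple `f * t` in `S` is a nonzero polynomial `P(y) = y^j Q(y)` with `Q(0) ≠ 0`; the
  -- bound will be `j * |N|`.
  obtain ⟨t, ht, ⟨r, hr⟩, hr0, hft⟩ := (isAlgebraic_adjoin_single (F := F) hfin hN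
    f).exists_nonzero_eq_adjoin_mul (mem_nonZeroDivisors_of_ne_zero hf0)
  have htS : t ∈ S := by
    refine Algebra.adjoin_induction (p := fun x _ => x ∈ S) ?_ ?_ ?_ ?_ ht
    · rintro x rfl; exact hf
    · exact fun a => hAS a.2
    · exact fun x z _ _ hx hz => S.add_mem hx hz
    · exact fun x z _ _ hx hz => S.mul_mem hx hz
  replace hft : f * t = r := hft
  have hr0' : r ≠ 0 := fun h => hr0 (Subtype.ext h)
  rw [Algebra.adjoin_singleton_eq_range_aeval] at hr
  obtain ⟨P, hP⟩ := hr
  replace hP : Polynomial.aeval y P = r := hP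
  have hP0 : P ≠ 0 := by rintro rfl; exact hr0' (by rw [← hP, map_zero])
  obtain ⟨Q, hPQ, hQ⟩ := P.exists_eq_pow_rootMultiplicity_mul_and_not_dvd hP0 0
  set j := P.rootMultiplicity 0
  rw [Polynomial.C_0, sub_zero] at hPQ hQ
  rw [hPQ, map_mul, map_pow, Polynomial.aeval_X] at hP
  have aeval_mem : ∀ q : Polynomial F, Polynomial.aeval y q ∈ S := fun q =>
    hAS (Polynomial.aeval_mem_adjoin_singleton _ _)
  refine ⟨j * N.natAbs, fun a d hd ha => ?_⟩
  rintro ⟨h, hh, rfl⟩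
  by_contra! hlt
  obtain ⟨m, hm, hdm⟩ := isOfFinOrder_iff_pow_eq_one.1 (hfin d hd)
  have hsign := nonneg_mul_of_single_mem (S := S.toSubring) hfin hy hyu hd ha
  have hpow : (single a d : AddMonoidAlgebra R ℤ) ^ (m * N.natAbs) = y ^ (m * a.natAbs) := by
    rw [hy_def, single_pow, single_pow, pow_mul d, hdm, one_pow, one_pow]
    congr 1
    rw [nsmul_eq_mul, nsmul_eq_mul]
    push_cast
    rcases mul_nonneg_iff.1 hsign with ⟨h1, h2⟩ | ⟨h1, h2⟩
    · rw [abs_of_nonneg h1, abs_of_nonneg h2]; ring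
    · rw [abs_of_nonpos h1, abs_of_nonpos h2]; ring
  -- Beyond the bound, at least one factor `y` is left after cancelling, so `y` divides a power of
  -- `Q(y)` in `S`, hence its nonzero constant term.
  obtain ⟨l, hl⟩ : ∃ l, m * a.natAbs = j * (m * N.natAbs) + (l + 1) := by
    have : j * (m * N.natAbs) < m * a.natAbs := by
      rw [mul_left_comm]; exact Nat.mul_lt_mul_of_pos_left hlt hm
    exact ⟨m * a.natAbs - j * (m * N.natAbs) - 1, by omega⟩
  have hmain : Polynomial.aeval y (Q ^ (m * N.natAbs)) =
      y * (y ^ l * (h * t) ^ (m * N.natAbs)) := by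
    refine mul_left_cancel₀ (pow_ne_zero (j * (m * N.natAbs)) hy0) ?_
    calc y ^ (j * (m * N.natAbs)) * Polynomial.aeval y (Q ^ (m * N.natAbs))
        = (y ^ j * Polynomial.aeval y Q) ^ (m * N.natAbs) := by rw [mul_pow, pow_mul, map_pow]
      _ = single a d ^ (m * N.natAbs) * (h * t) ^ (m * N.natAbs) := by
        rw [hP, ← hft, mul_assoc, mul_pow]
      _ = _ := by rw [hpow, hl, pow_add, pow_succ']; ring
  have hc : (Q ^ (m * N.natAbs)).coeff 0 ≠ 0 := by
    rw [Polynomial.X_dvd_iff] at hQ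
    rw [Polynomial.coeff_zero_eq_eval_zero, Polynomial.eval_pow,
      ← Polynomial.coeff_zero_eq_eval_zero]
    exact pow_ne_zero _ hQ
  set c := (Q ^ (m * N.natAbs)).coeff 0
  have hdiv := Polynomial.X_mul_divX_add (Q ^ (m * N.natAbs))
  rw [← hdiv, map_add, map_mul, Polynomial.aeval_X, Polynomial.aeval_C] at hmain
  have hsolve : algebraMap F (AddMonoidAlgebra R ℤ) c = y * (y ^ l * (h * t) ^ (m * N.natAbs) -
      Polynomial.aeval y (Q ^ (m * N.natAbs)).divX) := by
    rw [mul_sub, ← hmain]; ring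
  refine hyu (algebraMap F _ c⁻¹ * (y ^ l * (h * t) ^ (m * N.natAbs) -
      Polynomial.aeval y (Q ^ (m * N.natAbs)).divX)) ?_ ?_
  · exact S.mul_mem (S.algebraMap_mem _) (S.sub_mem (S.mul_mem (S.pow_mem hy _)
      (S.pow_mem (S.mul_mem hh htS) _)) (aeval_mem _))
  · rw [mul_left_comm, ← hsolve, ← map_mul, inv_mul_cancel₀ hc, map_one]

/-- The algebras of Laurent polynomials over an algebraic extension of a finite field satisfy the
ascending chain condition on principal ideals. -/
theorem wfDvdMonoid_subalgebra_int [IsDomain R] {F : Type*} [Field F] [Algebra F R] (hR : IsField R)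
    (hfin : ∀ c : R, c ≠ 0 → IsOfFinOrder c) (S : Subalgebra F (AddMonoidAlgebra R ℤ)) :
    WfDvdMonoid S.toSubring := by
  have := wfDvdMonoid_int hR
  -- If `S` loses no units, the chain condition descends directly with a constant measure.
  by_cases hS : ∀ g : S.toSubring, IsUnit (g : AddMonoidAlgebra R ℤ) → IsUnit g
  · exact S.toSubring.wfDvdMonoid_of_measure (fun _ => 0)
      fun f g _ hg hgu => absurd (hS g hgu) hg
  push Not at hS
  have single_of_unit : ∀ g : S.toSubring, IsUnit (g : AddMonoidAlgebra R ℤ) →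
      ∃ b x, x ≠ 0 ∧ (g : AddMonoidAlgebra R ℤ) = single b x := by
    intro g hg
    obtain ⟨v, hv⟩ := hg.exists_right_inv
    rw [one_def] at hv
    obtain ⟨b, x, _, _, hb, -, -, hxy⟩ := eq_single_of_mul_eq_single one_ne_zero hv
    exact ⟨b, x, left_ne_zero_of_mul (hxy ▸ one_ne_zero), hb⟩
  have pow_eq : ∀ (b : ℤ) (x : R), x ≠ 0 → ∃ e : ℕ, 0 < e ∧
      (single b x : AddMonoidAlgebra R ℤ) ^ e = single (e * b) 1 := by
    intro b x hx
    obtain ⟨e, he, hxe⟩ := isOfFinOrder_iff_pow_eq_one.1 (hfin x hx)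
    exact ⟨e, he, by rw [single_pow, hxe, nsmul_eq_mul]⟩
  have ne_zero_of_nonunit : ∀ (g : S.toSubring) (b : ℤ) (x : R), x ≠ 0 → ¬ IsUnit g →
      (g : AddMonoidAlgebra R ℤ) = single b x → b ≠ 0 := by
    rintro g b x hx hg hgb rfl
    obtain ⟨e, he, hpow⟩ := pow_eq 0 x hx
    rw [← hgb, mul_zero, ← one_def] at hpow
    exact hg (IsUnit.of_pow_eq_one (Subtype.ext hpow) he.ne')
  obtain ⟨u, huD, hu⟩ := hS
  obtain ⟨k, c, hc, huk⟩ := single_of_unit u huD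
  obtain ⟨e, he, hpow⟩ := pow_eq k c hc
  have hk : k ≠ 0 := ne_zero_of_nonunit u k c hc hu huk
  set N : ℤ := e * k
  have hN : N ≠ 0 := mul_ne_zero (by exact_mod_cast he.ne') hk
  have hue : ((u ^ e : S.toSubring) : AddMonoidAlgebra R ℤ) = single N 1 := by
    rw [Subring.coe_pow, huk, hpow]
  have hy : single N 1 ∈ S := hue ▸ (u ^ e).2
  have hyu : ∀ v ∈ S, (single N 1 : AddMonoidAlgebra R ℤ) * v ≠ 1 := by
    intro v hv h
    have : IsUnit (u ^ e) := IsUnit.of_mul_eq_one ⟨v, hv⟩ (Subtype.ext (by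
      rw [Subring.coe_mul, hue]; exact h))
    exact hu ((isUnit_pow_iff he.ne').1 this)
  let M : S.toSubring → Set ℕ := fun f => {n | ∃ a d, d ≠ 0 ∧ single a d ∈ S ∧
    (∃ h ∈ S, (f : AddMonoidAlgebra R ℤ) = single a d * h) ∧ a.natAbs = n}
  have hM : ∀ f : S.toSubring, f ≠ 0 → BddAbove (M f) := by
    intro f hf
    obtain ⟨B, hB⟩ := exists_natAbs_le_of_single_dvd hfin S hN hy hyu f.2
      (fun h => hf (Subtype.ext h))
    refine ⟨B, ?_⟩
    rintro _ ⟨a, d, hd, ha, hdvd, rfl⟩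
    exact hB a d hd ha hdvd
  -- The measure is the largest degree of a monomial divisor; the default value of `sSup` on
  -- unbounded sets can only matter at 0, which is excluded.
  refine S.toSubring.wfDvdMonoid_of_measure (fun f => sSup (M f)) fun f g hfg hg hgD => ?_
  obtain ⟨b, x, hx, hb⟩ := single_of_unit g hgD
  have hb0 : b ≠ 0 := ne_zero_of_nonunit g b x hx hg hb
  have hbS : single b x ∈ S := hb ▸ g.2
  have hbN := nonneg_mul_of_single_mem (S := S.toSubring) hfin hy hyu hx hbS
  have hne : (M f).Nonempty :=
    ⟨0, 0, 1, one_ne_zero, S.one_mem, ⟨f, f.2, (one_mul _).symm⟩, rfl⟩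
  obtain ⟨a, d, hd, ha, ⟨h, hh, hfh⟩, hsup⟩ :=
    Nat.sSup_mem hne (hM f (left_ne_zero_of_mul hfg))
  have haN := nonneg_mul_of_single_mem (S := S.toSubring) hfin hy hyu hd ha
  -- Both exponents have the sign of `N`, so degrees add without cancellation.
  have habs : (a + b).natAbs = a.natAbs + b.natAbs := by
    rcases lt_or_gt_of_ne hN with hN | hN
    · have := nonpos_of_mul_nonneg_left haN hN
      have := nonpos_of_mul_nonneg_left hbN hN
      omega
    · have := nonneg_of_mul_nonneg_left haN hN
      have := nonneg_of_mul_nonneg_left hbN hN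
      omega
  have hmem : (a + b).natAbs ∈ M (f * g) := by
    refine ⟨a + b, d * x, mul_ne_zero hd hx, ?_, ⟨h, hh, ?_⟩, rfl⟩
    · rw [← single_mul_single]; exact S.mul_mem ha hbS
    · rw [Subring.coe_mul, hfh, hb, ← single_mul_single]; ring
  have := le_csSup (hM _ hfg) hmem
  omega

theorem isHereditarilyAtomicDomain_int [IsDomain R] {p : ℕ}
    (h : IsAlgebraicExtensionOfPrimeField p R) :
    IsHereditarilyAtomicDomain (AddMonoidAlgebra R ℤ) := by
  obtain ⟨hp, hR, _, halg⟩ := h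
  have : Fact p.Prime := ⟨hp⟩
  refine ⟨inferInstance, fun S => ⟨inferInstance, fun a ha hu => ?_⟩⟩
  -- Every subring contains the image of `ℤ`, which is the prime field.
  let S' : Subalgebra (ZMod p) (AddMonoidAlgebra R ℤ) :=
    { S with
      algebraMap_mem' := fun z => by
        obtain ⟨n, rfl⟩ := ZMod.intCast_surjective z
        rw [map_intCast]
        exact intCast_mem S n }
  have : WfDvdMonoid S := wfDvdMonoid_subalgebra_int hR
    (fun c hc => isOfFinOrder_of_isAlgebraic (ZMod p) hc) S'
  obtain ⟨s, hs, hprod, -⟩ := (WfDvdMonoid.not_isUnit_iff_exists_factors_eq a ha).1 hu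
  exact ⟨s, hs, hprod⟩

end AddMonoidAlgebra

theorem mainTheorem4 {R : Type*} [CommRing R] [IsDomain R]
    {G : Type*} [AddCommGroup G] [Nontrivial G] :
    IsHereditarilyAtomicDomain (AddMonoidAlgebra R G) ↔
      (∃ p : ℕ, IsAlgebraicExtensionOfPrimeField p R) ∧ (IsAddCyclic G ∧ Infinite G) := by
  constructor
  · intro h
    have htf : IsAddTorsionFree G := isAddTorsionFree_of_isDomain h.1
    obtain ⟨g, hg⟩ := exists_ne (0 : G)
    have hinj : Injective (zmultiplesHom G g) := smul_left_injective ℤ hg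
    exact ⟨exists_isAlgebraicExtensionOfPrimeField_of_isHereditarilyAtomicDomain_int
      (h.of_injective_addMonoidHom _ hinj), isAddCyclic_of_isHereditarilyAtomicDomain h,
      Infinite.of_injective _ hinj⟩
  · rintro ⟨⟨p, hp⟩, hcyc, hinf⟩
    let e : ℤ ≃+ G := intCyclicAddEquiv
    exact (isHereditarilyAtomicDomain_int hp).of_injective_addMonoidHom
      e.symm.toAddMonoidHom e.symm.injective
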